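/- Let $K\subset\mathbb{C}$ be a totally real field, i.e. an algebraic extension of $\mathbb{Q}$ (possibly of infinite degree) all of whose embeddings into $\mathbb{C}$ have image in $\mathbb{R}$, and let $\mathcal{O}_K$ be its ring of algebraic integers. An element $x\in K$ is totally positive, written $x\succ 0$, if $\sigma(x)>0$ for every embedding $\sigma:K\to\mathbb{R}$. Let $\mathcal{O}_K^{\times 2}$ be the group of squares of units of $\mathcal{O}_K$ and $\mathcal{O}_K^{\times,+}$ the group of totally positive units of $\mathcal{O}_K$. Let $K^{\times 2}$ be the group of squares of nonzero elements of $K$. A quadratic lattice over $K$ is a pair $(\mathcal{L},Q)$, where $\mathcal{L}$ is a finitely generated torsion-free $\mathcal{O}_K$-module and $Q:\mathcal{L}\to\mathcal{O}_K$ is a map such that $Q(av)=a^2Q(v)$ for all $a\in\mathcal{O}_K$, $v\in\mathcal{L}$, and such that $(v,w)\mapsto Q(v+w)-Q(v)-Q(w)$ is $\mathcal{O}_K$-bilinear. Its rank is $\dim_K(\mathcal{L}\otimes_{\mathcal{O}_K}K)$. It represents $d\in\mathcal{O}_K$ if $d=Q(v)$ for some $v\in\mathcal{L}$, and it represents a class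 of $\mathcal{O}_K^{\times,+}/\mathcal{O}_K^{\times 2}$ if it represents some element of that class. It is positive definite if $Q(v)\succ 0$ for all $v\in\mathcal{L}\setminus\{0\}$, and universal if it is positive definite and represents every totally positive element of $\mathcal{O}_K$. For $a\in\mathbb{Q}$ put $g(a)=e^{2\pi i a}+e^{-2\pi i a}=2\cos(2\pi a)$. There is at most one integer $m>0$ with $g(1/2^m)^2\in K$ and $g(1/2^m)\notin K$; put $\gamma_K=g(1/2^m)^2$ if such an $m$ exists and $\gamma_K=-1$ otherwise. **Theorem.** Let $K$ be a totally real field. 1. Every positive definite quadratic lattice over $K$ of rank $n\ge 2$ represents at most $2n-2$ classes of $\mathcal{O}_K^{\times,+}/\mathcal{O}_K^{\times 2}$. 2. If moreover $\gamma_K K^{\times 2}\cap\mathcal{O}_K^{\times,+}=\emptyset$, then every such lattice represents at most $n$ classes of $\mathcal{O}_K^{\times,+}/\mathcal{O}_K^{\times 2}$. 3. In particular, if $\mathcal{O}_K^{\times,+}/\mathcal{O}_K^{\times 2}$ is infinite, then there is no universal quadratic lattice over $K$. -/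

import Mathlib

open scoped NumberField TensorProduct

namespace QuadLat

/-- An element `x` of a field `K` is totally positive (`x ≻ 0`) if `σ x > 0` for every embedding
`σ : K → ℝ`. It is used for totally real fields only. -/
def IsTotallyPositive {K : Type*} [Field K] (x : K) : Prop :=
  ∀ σ : K →+* ℝ, 0 < σ x

/-- The group of totally positive units of the ring of integers of `K`. -/
def totallyPositiveUnits (K : Type*) [Field K] : Subgroup (𝓞 K)ˣ where
  carrier := {u | IsTotallyPositive ((u : 𝓞 K) : K)}
  one_mem' := fun σ => by simp
  mul_mem' := fun {a b} ha hb σ => by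
    simpa using mul_pos (ha σ) (hb σ)
  inv_mem' := fun {a} ha σ => by
    have h : σ ((a : 𝓞 K) : K) * σ (((a⁻¹ : (𝓞 K)ˣ) : 𝓞 K) : K) = 1 := by
      rw [← map_mul, ← map_mul (algebraMap (𝓞 K) K)]
      simp
    exact pos_of_mul_pos_right (h ▸ one_pos) (ha σ).le

/-- The group of squares of units of the ring of integers of `K`. -/
def unitSquares (K : Type*) [Field K] : Subgroup (𝓞 K)ˣ :=
  (powMonoidHom 2 : (𝓞 K)ˣ →* (𝓞 K)ˣ).range

/-- The quotient of the group of totally positive units by its subgroup of squares of units. -/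
abbrev UnitSquareClasses (K : Type*) [Field K] : Type _ :=
  totallyPositiveUnits K ⧸ (unitSquares K).subgroupOf (totallyPositiveUnits K)

section Lattice

variable {K : Type*} [Field K] {L : Type*} [AddCommGroup L] [Module (𝓞 K) L]

/-- The element `d` is represented by `Q` if `d = Q v` for some `v`. -/
def Represents (Q : QuadraticForm (𝓞 K) L) (d : 𝓞 K) : Prop :=
  ∃ v : L, Q v = d

/-- The classes of totally positive units modulo squares of units that are represented by `Q`,
that is, those with a representative (a totally positive unit) represented by `Q`. -/
def representedClasses (Q : QuadraticForm (𝓞 K) L) : Set (UnitSquareClasses K) :=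
  {c | ∃ u : totallyPositiveUnits K, (u : UnitSquareClasses K) = c ∧
    Represents Q ((u : (𝓞 K)ˣ) : 𝓞 K)}

/-- `Q` is positive definite if `Q v ≻ 0` for all `v ≠ 0`. -/
def IsPositiveDefinite (Q : QuadraticForm (𝓞 K) L) : Prop :=
  ∀ v : L, v ≠ 0 → IsTotallyPositive ((Q v : 𝓞 K) : K)

/-- `Q` is universal if it is positive definite and represents all totally positive elements of
the ring of integers. -/
def IsUniversal (Q : QuadraticForm (𝓞 K) L) : Prop :=
  IsPositiveDefinite Q ∧ ∀ d : 𝓞 K, IsTotallyPositive (d : K) → Represents Q d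

variable (K L) in
/-- The rank of a quadratic lattice: the `K`-dimension of its scalar extension to `K`. -/
noncomputable def latticeRank : ℕ :=
  Module.finrank K (K ⊗[𝓞 K] L)

end Lattice

/-- `g a = e^{2πia} + e^{-2πia} = 2 cos (2πa)`. -/
noncomputable def g (a : ℚ) : ℂ :=
  Complex.exp (2 * Real.pi * Complex.I * a) + Complex.exp (-(2 * Real.pi * Complex.I * a))

/-- The condition on `m` that determines `γ_K`. -/
def IsGammaIndex (K : IntermediateField ℚ ℂ) (m : ℕ) : Prop :=
  0 < m ∧ g (1 / 2 ^ m) ^ 2 ∈ K ∧ g (1 / 2 ^ m) ∉ K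

theorem g_sq (a : ℚ) : g a ^ 2 = 2 + g (2 * a) := by
  have h : Complex.exp (2 * Real.pi * Complex.I * a) *
      Complex.exp (-(2 * Real.pi * Complex.I * a)) = 1 := by
    rw [← Complex.exp_add, add_neg_cancel, Complex.exp_zero]
  have h1 : Complex.exp (2 * Real.pi * Complex.I * (2 * a : ℚ)) =
      Complex.exp (2 * Real.pi * Complex.I * a) ^ 2 := by
    rw [← Complex.exp_nat_mul]; push_cast; ring_nf
  have h2 : Complex.exp (-(2 * Real.pi * Complex.I * (2 * a : ℚ))) =
      Complex.exp (-(2 * Real.pi * Complex.I * a)) ^ 2 := by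
    rw [← Complex.exp_nat_mul]; push_cast; ring_nf
  simp only [g]
  rw [h1, h2]
  linear_combination 2 * h

/-- At most one index `m` satisfies the condition, so `γ_K` below is well defined. -/
theorem IsGammaIndex.unique {K : IntermediateField ℚ ℂ} {m m' : ℕ}
    (h : IsGammaIndex K m) (h' : IsGammaIndex K m') : m = m' := by
  have step : ∀ k : ℕ, g (1 / 2 ^ (k + 1)) ^ 2 ∈ K → g (1 / 2 ^ k) ∈ K := by
    intro k hk
    have e : (2 : ℚ) * (1 / 2 ^ (k + 1)) = 1 / 2 ^ k := by rw [pow_succ]; field_simp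
    rw [g_sq, e] at hk
    have h2 : (2 : ℂ) ∈ K := ofNat_mem K 2
    simpa using K.sub_mem hk h2
  have desc : ∀ d k : ℕ, g (1 / 2 ^ (k + d)) ∈ K → g (1 / 2 ^ k) ∈ K := by
    intro d
    induction d with
    | zero => intro k hk; exact hk
    | succ d ih => intro k hk; exact ih k (step _ (pow_mem hk 2))
  have key : ∀ {i j : ℕ}, IsGammaIndex K i → IsGammaIndex K j → ¬ i < j := by
    intro i j hi hj hij
    obtain ⟨d, rfl⟩ := Nat.exists_eq_add_of_lt hij
    exact hi.2.2 (desc d i (step _ hj.2.1))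
  exact le_antisymm (not_lt.mp (key h' h)) (not_lt.mp (key h h'))

open Classical in
/-- `γ_K = g(1/2^m)²` if `m > 0` is such that `g(1/2^m)² ∈ K` but `g(1/2^m) ∉ K`, and `γ_K = -1`
if no such `m` exists. -/
noncomputable def gamma (K : IntermediateField ℚ ℂ) : K :=
  if h : ∃ m : ℕ, IsGammaIndex K m then
    ⟨g (1 / 2 ^ h.choose) ^ 2, h.choose_spec.2.1⟩
  else -1

end QuadLat

namespace QuadLat

/-! Let `v`, `v'` represent totally positive units `u`, `w`, with polar value `B`. Then `x = B² /
(uw)` is an algebraic integer, and Cauchy–Schwarz puts all its conjugates in `[0, 4]`; Kronecker's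
theorem yields `x = g(a)²` with `a` rational (`exists_eq_g_sq`).

For `x ≠ 0`, sorting by the power of 2 in the denominator of `a` (`g_sq_trichotomy`) leaves three
cases. If `x` is a square in `K`, then so is `uw`, and the classes agree. If `x ∈ γ_K K^{×2}`, then
so is `uw`. Otherwise `4 - x` is the square of a unit, and the component of `v'` orthogonal to `v`
rescales to a lattice vector that still represents `w` (`exists_orthogonal`).

So the orthogonal complement of `v` keeps every represented class except that of `u` and at most one
`γ_K`-related class. Induction on the maximal size of an orthogonal system loses one class per
dimension without `γ_K`-relations, and two in general. In the general case the base is dimension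
two, with at most two classes, whence `2 + 2(n - 2)`. -/

/-! ### Cosine values `g a` and the subfield `K`. -/

theorem g_neg (a : ℚ) : g (-a) = g a := by
  simp only [g, Rat.cast_neg, mul_neg, neg_neg]
  rw [add_comm]

theorem g_mul (a b : ℚ) : g a * g b = g (a + b) + g (a - b) := by
  simp only [g]
  rw [add_mul, mul_add, mul_add, ← Complex.exp_add, ← Complex.exp_add, ← Complex.exp_add,
    ← Complex.exp_add]
  push_cast
  ring_nf

theorem g_zero : g 0 = 2 := by
  norm_num [g]

theorem g_add_int (a : ℚ) (k : ℤ) : g (a + k) = g a := by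
  have h1 : (2 * Real.pi * Complex.I * ((a + k : ℚ) : ℂ) : ℂ) =
      2 * Real.pi * Complex.I * a + k * (2 * Real.pi * Complex.I) := by
    push_cast; ring
  simp only [g, h1, Complex.exp_neg, Complex.exp_periodic.int_mul k _]

theorem g_eq_cos (a : ℚ) : g a = ((2 * Real.cos (2 * Real.pi * a) : ℝ) : ℂ) := by
  push_cast
  rw [Complex.two_cos, g]
  ring_nf

theorem g_half_add (a : ℚ) : g (1 / 2 + a) = -g a := by
  rw [g_eq_cos, g_eq_cos]
  have : 2 * Real.pi * ((1 / 2 + a : ℚ) : ℝ) = 2 * Real.pi * a + Real.pi := by push_cast; ring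
  rw [this, Real.cos_add_pi]
  push_cast; ring

/-- This is `sin² + cos² = 1`; it is the source of the case where `4 - x` is a square. -/
theorem g_quarter_add_sq (a : ℚ) : g (1 / 4 + a) ^ 2 = 4 - g a ^ 2 := by
  rw [g_sq, g_sq, show (2 : ℚ) * (1 / 4 + a) = 1 / 2 + 2 * a by ring, g_half_add]
  ring

/-- The angle is at most `π / 4`. The bound on `s` is sharp, since `g (1 / 4) = 0`. -/
theorem g_one_div_two_pow_ne_zero {s : ℕ} (hs : 3 ≤ s) : g (1 / 2 ^ s) ≠ 0 := by
  rw [g_eq_cos, Complex.ofReal_ne_zero]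
  have h8 : (8 : ℝ) ≤ 2 ^ s := by
    calc (8 : ℝ) = 2 ^ 3 := by norm_num
      _ ≤ 2 ^ s := pow_le_pow_right₀ (by norm_num) hs
  have h : (1 : ℝ) / 2 ^ s ≤ 1 / 8 := one_div_le_one_div_of_le (by norm_num) h8
  have h0 : (0 : ℝ) < 1 / 2 ^ s := by positivity
  have hpi := Real.pi_pos
  refine mul_ne_zero two_ne_zero (Real.cos_pos_of_mem_Ioo ⟨?_, ?_⟩).ne'
  · push_cast
    nlinarith
  · push_cast
    nlinarith

/-- If `g a` lies in a subfield, so does `g (k * a)` for every natural number `k`. -/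
theorem g_natCast_mul_mem {K : IntermediateField ℚ ℂ} {a : ℚ} (h : g a ∈ K) (k : ℕ) :
    g (k * a) ∈ K := by
  induction k using Nat.strong_induction_on with
  | _ k ih =>
    match k with
    | 0 => simp [g_zero]
    | 1 => simpa using h
    | k + 2 =>
      -- Chebyshev recurrence `g((k+2)a) = g((k+1)a) g(a) - g(ka)`.
      have h1 := g_mul ((k + 1 : ℕ) * a) a
      have e1 : ((k + 1 : ℕ) * a + a : ℚ) = (k + 2 : ℕ) * a := by push_cast; ring
      have e2 : ((k + 1 : ℕ) * a - a : ℚ) = k * a := by push_cast; ring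
      rw [e1, e2] at h1
      have := K.sub_mem (K.mul_mem (ih (k + 1) (by omega)) h) (ih k (by omega))
      rwa [h1, add_sub_cancel_right] at this

theorem g_intCast_mul_mem {K : IntermediateField ℚ ℂ} {a : ℚ} (h : g a ∈ K) (k : ℤ) :
    g (k * a) ∈ K := by
  obtain ⟨n, rfl | rfl⟩ := k.eq_nat_or_neg
  · exact_mod_cast g_natCast_mul_mem h n
  · have := g_natCast_mul_mem h n
    rw [← g_neg] at this
    simpa using this

/-- If `K` contains the trace of one primitive root of unity squared, it contains the traces of
the squares of all roots of unity of that order. -/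
theorem g_two_mul_div_mem {K : IntermediateField ℚ ℂ} {a : ℚ} (h : g (2 * a) ∈ K) (k : ℤ) :
    g (2 * k / a.den) ∈ K := by
  have hq : (a.den : ℚ) ≠ 0 := by exact_mod_cast a.den_nz
  have hc : IsCoprime a.num (a.den : ℤ) := by
    rw [Int.isCoprime_iff_gcd_eq_one]
    exact a.reduced
  obtain ⟨u, v, huv⟩ := hc
  -- `u` inverts the numerator modulo the denominator, so `ku · 2a` is `2k / a.den` up to an
  -- integer.
  have h1 := g_intCast_mul_mem h (k * u)
  have e : (2 * k / a.den : ℚ) = (k * u : ℤ) * (2 * a) + (2 * k * v : ℤ) := by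
    have h2 : (u * a.num + v * a.den : ℚ) = 1 := by exact_mod_cast huv
    have h3 : a * a.den = a.num := Rat.mul_den_eq_num a
    push_cast
    field_simp
    linear_combination (-(k : ℚ)) * h2 - k * u * h3
  rw [e, g_add_int]
  exact h1

theorem isIntegral_exp (b : ℚ) : IsIntegral ℤ (Complex.exp (2 * Real.pi * Complex.I * b)) := by
  refine IsIntegral.of_pow (n := b.den) b.den_pos ?_
  rw [← Complex.exp_nat_mul]
  have hq : (b.den : ℂ) ≠ 0 := by exact_mod_cast b.den_nz
  have h3 : (b : ℂ) = b.num / b.den := by exact_mod_cast (Rat.num_div_den b).symm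
  have : (b.den : ℂ) * (2 * Real.pi * Complex.I * b) = b.num * (2 * Real.pi * Complex.I) := by
    rw [h3]; field_simp
  rw [this, Complex.exp_int_mul_two_pi_mul_I]
  exact isIntegral_one

/-- The trace `ζ + ζ⁻¹` of a root of unity of odd order different from `1` is a unit. -/
theorem isIntegral_g_inv {t : ℕ} (ht : Odd t) (j : ℤ) (h2 : g (j / t) ^ 2 ≠ 4) :
    IsIntegral ℤ (g (j / t))⁻¹ ∧ g (j / t) ≠ 0 := by
  set ζ := Complex.exp (2 * Real.pi * Complex.I * (j / t : ℚ)) with hζ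
  have ht0 : (t : ℂ) ≠ 0 := by exact_mod_cast ht.pos.ne'
  have hζt : ζ ^ t = 1 := by
    rw [hζ, ← Complex.exp_nat_mul]
    have : (t : ℂ) * (2 * Real.pi * Complex.I * ((j / t : ℚ) : ℂ)) =
        j * (2 * Real.pi * Complex.I) := by
      push_cast; field_simp
    rw [this, Complex.exp_int_mul_two_pi_mul_I]
  have hg : g (j / t) = ζ + ζ⁻¹ := by
    rw [g, Complex.exp_neg]
  have hζ0 : ζ ≠ 0 := Complex.exp_ne_zero _
  have hint : IsIntegral ℤ ζ := isIntegral_exp _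
  obtain ⟨r, hr⟩ := ht
  set z := ζ ^ 2 with hz
  have hzt : z ^ t = 1 := by rw [hz, ← pow_mul, mul_comm, pow_mul, hζt, one_pow]
  have hz1 : z ≠ 1 := by
    intro h
    apply h2
    have : ζ⁻¹ = ζ := by
      rw [inv_eq_iff_eq_inv, ← mul_eq_one_iff_eq_inv₀ hζ0, ← sq]; exact h
    rw [hg, this]
    linear_combination 4 * h
  -- `S` is the inverse of `1 + z`: as `t = 2r + 1`, `(z - 1)(z + 1) S = z^(t+1) - 1 = z - 1`.
  set S := ∑ i ∈ Finset.range (r + 1), (z ^ 2) ^ i with hS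
  have hS1 : (1 + z) * S = 1 := by
    have h1 : S * (z ^ 2 - 1) = (z ^ 2) ^ (r + 1) - 1 := geom_sum_mul _ _
    have h4 : (z ^ 2) ^ (r + 1) = z := by
      rw [← pow_mul, show 2 * (r + 1) = t + 1 by omega, pow_succ, hzt, one_mul]
    rw [h4] at h1
    have h5 : z - 1 ≠ 0 := sub_ne_zero.mpr hz1
    apply mul_right_cancel₀ h5
    linear_combination h1
  have hmul : g (j / t) * (ζ * S) = 1 := by
    rw [hg, ← hS1, hz]
    field_simp
    ring
  have hne : g (j / t) ≠ 0 := left_ne_zero_of_mul_eq_one hmul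
  refine ⟨?_, hne⟩
  rw [inv_eq_of_mul_eq_one_right hmul]
  exact hint.mul (IsIntegral.sum _ fun i _ => ((hint.pow 2).pow 2).pow i)

/-- The squares `g a ^ 2` in `K`, up to squares of `K`. -/
theorem g_sq_trichotomy {K : IntermediateField ℚ ℂ} {a : ℚ} (h : g a ^ 2 ∈ K) (h0 : g a ≠ 0) :
    g a ∈ K ∨ (∃ y ∈ K, y ≠ 0 ∧ g a ^ 2 = (gamma K : ℂ) * y ^ 2) ∨
      ∃ y ∈ K, y ≠ 0 ∧ IsIntegral ℤ y⁻¹ ∧ 4 - g a ^ 2 = y ^ 2 := by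
  have h2a : g (2 * a) ∈ K := by
    rw [g_sq] at h
    simpa using K.sub_mem h (ofNat_mem K 2)
  have hA := g_two_mul_div_mem h2a
  obtain ⟨s, t, ht, hst⟩ := Nat.exists_eq_two_pow_mul_odd a.den_nz
  have ht0 : (t : ℚ) ≠ 0 := by exact_mod_cast ht.pos.ne'
  have hapq : a = a.num / a.den := (Rat.num_div_den a).symm
  have htZ : Odd (t : ℤ) := by exact_mod_cast ht
  have hp : s ≠ 0 → Odd a.num := by
    intro hs
    by_contra he
    rw [Int.not_odd_iff_even] at he
    have h1 : 2 ∣ a.num.natAbs := Int.natCast_dvd.mp he.two_dvd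
    have h3 : 2 ∣ a.den := hst ▸ (dvd_pow_self 2 hs).mul_right t
    have := Nat.dvd_gcd h1 h3
    rw [a.reduced] at this
    omega
  match s with
  | 0 =>
    left
    simp only [pow_zero, one_mul] at hst
    rcases Int.even_or_odd a.num with ⟨k, hk⟩ | ho
    · have e : a = 2 * k / a.den := by
        conv_lhs => rw [hapq, hk]
        push_cast; ring
      rw [e]; exact hA k
    · obtain ⟨k, hk⟩ := ho.sub_odd htZ
      have hk' : (a.num : ℚ) - t = k + k := by exact_mod_cast hk
      have e : a = 2 * k / a.den + (1 : ℤ) := by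
        conv_lhs => rw [hapq]
        rw [hst]; push_cast; field_simp
        linear_combination hk'
      rw [e, g_add_int]; exact hA k
  | 1 =>
    left
    obtain ⟨k, hk⟩ := (hp one_ne_zero).sub_odd htZ
    have hk' : (a.num : ℚ) - t = k + k := by exact_mod_cast hk
    have e : a = 1 / 2 + 2 * k / a.den := by
      conv_lhs => rw [hapq]
      rw [hst]; push_cast; field_simp
      linear_combination hk'
    rw [e, g_half_add]; exact K.neg_mem (hA k)
  | 2 =>
    right; right
    -- Both the numerator and `t` are odd, so the numerator is `t` or `-t` modulo 4; hence `a` or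
    -- `-a` equals `1/4 + j/t`.
    have main : ∃ j : ℤ, g a ^ 2 = 4 - g (j / t) ^ 2 := by
      obtain ⟨k, hk⟩ := hp two_ne_zero
      obtain ⟨r, hr⟩ := htZ
      rcases Int.even_or_odd (k - r) with ⟨j, hj⟩ | ⟨j, hj⟩
      · refine ⟨j, ?_⟩
        have e : (a.num : ℚ) = t + 4 * j := by
          have : a.num = t + 4 * j := by omega
          exact_mod_cast this
        rw [← g_quarter_add_sq]
        congr 2
        conv_lhs => rw [hapq]
        rw [hst, e]; push_cast; field_simp
      · refine ⟨-(k + r + 1) / 2, ?_⟩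
        have e : (a.num : ℚ) = -(t + 4 * ((-(k + r + 1) / 2 : ℤ) : ℚ)) := by
          have : a.num = -(t + 4 * (-(k + r + 1) / 2)) := by omega
          exact_mod_cast this
        rw [← g_quarter_add_sq, ← g_neg]
        congr 2
        conv_lhs => rw [hapq]
        rw [hst, e]; push_cast; field_simp
    obtain ⟨j, hj⟩ := main
    have hjK : g (j / t) ∈ K := by
      have := hA (2 * j)
      rw [hst] at this
      convert this using 2
      push_cast; field_simp; ring
    have hne : g (j / t) ^ 2 ≠ 4 := by
      intro h4
      rw [h4, sub_self] at hj
      exact h0 (pow_eq_zero_iff two_ne_zero |>.mp hj)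
    have hu := isIntegral_g_inv ht j hne
    exact ⟨_, hjK, hu.2, hu.1, by rw [hj]; ring⟩
  | s + 3 =>
    have hs0 := g_one_div_two_pow_ne_zero (s := s + 3) (by omega)
    have hq : (a.den : ℚ) = 2 ^ (s + 3) * t := by rw [hst]; push_cast; rfl
    -- The numerator plus or minus `t` is even, so both terms of the product formula have the form
    -- `g (2k / a.den)`.
    have hprod : g a * g (1 / 2 ^ (s + 3)) ∈ K := by
      rw [g_mul]
      obtain ⟨k, hk⟩ := (hp (by omega)).add_odd htZ
      obtain ⟨l, hl⟩ := (hp (by omega)).sub_odd htZ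
      have hk' : (a.num : ℚ) + t = k + k := by exact_mod_cast hk
      have hl' : (a.num : ℚ) - t = l + l := by exact_mod_cast hl
      have e1 : a + 1 / 2 ^ (s + 3) = 2 * k / a.den := by
        conv_lhs => rw [hapq]
        rw [hq]; field_simp; linear_combination hk'
      have e2 : a - 1 / 2 ^ (s + 3) = 2 * l / a.den := by
        conv_lhs => rw [hapq]
        rw [hq]; field_simp; linear_combination hl'
      rw [e1, e2]
      exact K.add_mem (hA k) (hA l)
    have hsq : g (1 / 2 ^ (s + 3)) ^ 2 ∈ K := by
      rw [g_sq]
      refine K.add_mem (ofNat_mem K 2) ?_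
      convert hA t using 2
      rw [hq]; push_cast; field_simp
    by_cases hK : g (1 / 2 ^ (s + 3)) ∈ K
    · left
      have := K.div_mem hprod hK
      rwa [mul_div_cancel_right₀ _ hs0] at this
    · right; left
      have hidx : IsGammaIndex K (s + 3) := ⟨by omega, hsq, hK⟩
      have hγ : (gamma K : ℂ) = g (1 / 2 ^ (s + 3)) ^ 2 := by
        have hex : ∃ m, IsGammaIndex K m := ⟨_, hidx⟩
        rw [gamma, dif_pos hex]
        simp only [hex.choose_spec.unique hidx]
      refine ⟨g a * g (1 / 2 ^ (s + 3)) / g (1 / 2 ^ (s + 3)) ^ 2, K.div_mem hprod hsq, ?_, ?_⟩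
      · exact div_ne_zero (mul_ne_zero h0 hs0) (pow_ne_zero 2 hs0)
      · rw [hγ]; field_simp


/-! ### Kronecker's theorem. -/

/-- The roots of `z ^ 2 - r z + 1` lie on the unit circle if `r ∈ [-2, 2]`. -/
theorem norm_eq_one_of_sq_add_one {w : ℂ} {r : ℝ} (hr : r ^ 2 ≤ 4) (h : w ^ 2 + 1 = r * w) :
    ‖w‖ = 1 := by
  have hre := congrArg Complex.re h
  have him := congrArg Complex.im h
  simp only [sq, Complex.add_re, Complex.mul_re, Complex.one_re, Complex.ofReal_re,
    Complex.ofReal_im, zero_mul, sub_zero, Complex.add_im, Complex.mul_im, Complex.one_im,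
    add_zero] at hre him
  have key : w.re * w.re + w.im * w.im = 1 := by
    -- A real root forces `w = ±1`, as the discriminant is at most 0; otherwise the roots are
    -- conjugate with product 1.
    by_cases hi : w.im = 0
    · rw [hi] at hre ⊢
      nlinarith [sq_nonneg (2 * w.re - r), sq_nonneg (w.re - 1), sq_nonneg (w.re + 1)]
    · have h1 : 2 * w.re = r := by
        apply mul_right_cancel₀ hi
        linear_combination him
      rw [← h1] at hre
      linear_combination -hre
  rw [← sq_eq_sq₀ (norm_nonneg w) zero_le_one, Complex.sq_norm, Complex.normSq_apply, key]
  norm_num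

/-- **Kronecker's theorem** for totally real integers: if all conjugates of `x` lie in `[0, 4]`,
then `x` is the square of `g a` for some rational `a`. -/
theorem exists_eq_g_sq {K : IntermediateField ℚ ℂ} [Algebra.IsAlgebraic ℚ K]
    [NumberField.IsTotallyReal K] {x : K} (hx : IsIntegral ℤ x)
    (h : ∀ σ : K →+* ℝ, 0 ≤ σ x ∧ σ x ≤ 4) : ∃ a : ℚ, (x : ℂ) = g a ^ 2 := by
  -- With `z + z⁻¹ = x - 2`, conjugates of `x - 2` in `[-2, 2]` put the conjugates of `z` on the
  -- unit circle.
  obtain ⟨z, hz⟩ : ∃ z : ℂ, z ^ 2 + 1 = ((x : ℂ) - 2) * z := by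
    obtain ⟨s, hs⟩ := IsAlgClosed.exists_pow_nat_eq (((x : ℂ) - 2) ^ 2 - 4) (n := 2) two_pos
    refine ⟨((x : ℂ) - 2 + s) / 2, ?_⟩
    linear_combination hs / 4
  have hz0 : z ≠ 0 := by
    rintro rfl
    norm_num at hz
  have hxC : IsIntegral ℤ (x : ℂ) := hx.map (algebraMap K ℂ).toIntAlgHom
  have hzint : IsIntegral ℤ z := by
    have h2 : IsIntegral ℤ (2 : ℂ) := by exact_mod_cast isIntegral_algebraMap (R := ℤ) (x := 2)
    let A := integralClosure ℤ ℂ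
    let x' : A := ⟨(x : ℂ) - 2, hxC.sub h2⟩
    refine isIntegral_trans (A := A) z ?_
    refine ⟨Polynomial.X ^ 2 - Polynomial.C x' * Polynomial.X + 1, by monicity!, ?_⟩
    simp only [Polynomial.eval₂_add, Polynomial.eval₂_sub, Polynomial.eval₂_mul,
      Polynomial.eval₂_pow, Polynomial.eval₂_X, Polynomial.eval₂_C, Polynomial.eval₂_one]
    change z ^ 2 - ((x : ℂ) - 2) * z + 1 = 0
    linear_combination hz
  have hzQ : IsIntegral ℚ z := hzint.tower_top
  -- `K` may have infinite degree, so the argument runs in the number field `ℚ(z)`, which contains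
  -- `x`.
  let F := IntermediateField.adjoin ℚ {z}
  have : FiniteDimensional ℚ F := IntermediateField.adjoin.finiteDimensional hzQ
  have : NumberField F := ⟨⟩
  let z' : F := ⟨z, IntermediateField.mem_adjoin_simple_self ℚ z⟩
  have hz'0 : z' ≠ 0 := fun h0 => hz0 (congrArg Subtype.val h0)
  let x' : F := (z' ^ 2 + 1) / z' + 2
  have hx' : (x' : ℂ) = x := by
    change (z ^ 2 + 1) / z + 2 = x
    rw [hz]; field_simp; ring
  have hz' : z' ^ 2 + 1 = (x' - 2) * z' := by
    simp only [x']; field_simp; ring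
  have hz'int : IsIntegral ℤ z' :=
    (isIntegral_algHom_iff (algebraMap F ℂ).toIntAlgHom (algebraMap F ℂ).injective).mp hzint
  obtain ⟨n, hn, hpow⟩ := NumberField.Embeddings.pow_eq_one_of_norm_eq_one F ℂ hz'int fun φ => by
    -- An embedding of `F` need not come from one of `K`, but `φ x'` is a root of the minimal
    -- polynomial of `x`, hence the image of `x` under some embedding of `K`.
    have hroot : φ x' ∈ (minpoly ℚ x).rootSet ℂ := by
      rw [Polynomial.mem_rootSet]
      refine ⟨minpoly.ne_zero (Algebra.IsIntegral.isIntegral x), ?_⟩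
      have e1 : Polynomial.aeval x' (minpoly ℚ x) = 0 := by
        apply (algebraMap F ℂ).injective
        rw [← Polynomial.aeval_algebraMap_apply, map_zero]
        change Polynomial.aeval (x' : ℂ) _ = 0
        rw [hx', show (x : ℂ) = algebraMap K ℂ x from rfl, Polynomial.aeval_algebraMap_apply,
          minpoly.aeval, map_zero]
      have := congrArg φ.toRatAlgHom e1
      rw [← Polynomial.aeval_algHom_apply, map_zero] at this
      exact this
    rw [← Algebra.IsAlgebraic.range_eval_eq_rootSet_minpoly ℂ x] at hroot
    obtain ⟨ψ, hψ⟩ := hroot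
    have hre := NumberField.IsTotallyReal.complexEmbedding_isReal (ψ : K →+* ℂ)
    have hb := h hre.embedding
    have hv : ((hre.embedding x : ℝ) : ℂ) = φ x' := by
      rw [NumberField.ComplexEmbedding.IsReal.coe_embedding_apply]; exact hψ
    refine norm_eq_one_of_sq_add_one (r := hre.embedding x - 2) (by nlinarith [hb.1, hb.2]) ?_
    have := congrArg φ hz'
    simp only [map_add, map_mul, map_sub, map_pow, map_one, map_ofNat] at this
    rw [this, ← hv]
    push_cast; ring
  have hzn : z ^ n = 1 := congrArg Subtype.val hpow
  obtain ⟨m, hm, hprim⟩ : ∃ m, m ≠ 0 ∧ IsPrimitiveRoot z m :=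
    ⟨orderOf z, (orderOf_pos_iff.mpr (isOfFinOrder_iff_pow_eq_one.mpr ⟨n, hn, hzn⟩)).ne',
      IsPrimitiveRoot.orderOf z⟩
  obtain ⟨i, -, -, hi⟩ := (Complex.isPrimitiveRoot_iff z m hm).mp hprim
  refine ⟨i / m / 2, ?_⟩
  have hg : g (i / m) = z + z⁻¹ := by
    rw [g, Complex.exp_neg]
    push_cast
    rw [hi]
  rw [g_sq, mul_div_cancel₀ _ two_ne_zero, hg]
  field_simp
  linear_combination -hz


/-! ### Unit classes and the relation given by `γ_K`. -/

variable {K : IntermediateField ℚ ℂ}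

/-- Without a real embedding total positivity would be vacuous. -/
theorem exists_ringHom_real (K : IntermediateField ℚ ℂ) [NumberField.IsTotallyReal K] :
    Nonempty (K →+* ℝ) :=
  ⟨(NumberField.IsTotallyReal.complexEmbedding_isReal (algebraMap K ℂ)).embedding⟩

theorem coe_unit_ne_zero (u : (𝓞 K)ˣ) : ((u : 𝓞 K) : K) ≠ 0 := by
  simp

/-- Two totally positive units whose product is a square in `K` lie in the same class. -/
theorem class_eq_of_mul_eq_sq {u w : totallyPositiveUnits K} {z : K}
    (h : (((u : (𝓞 K)ˣ) : 𝓞 K) : K) * (((w : (𝓞 K)ˣ) : 𝓞 K) : K) = z ^ 2) :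
    (u : UnitSquareClasses K) = w := by
  have hz : IsIntegral ℤ z := by
    refine IsIntegral.of_pow two_pos ?_
    rw [← h]
    exact (NumberField.RingOfIntegers.isIntegral_coe _).mul
      (NumberField.RingOfIntegers.isIntegral_coe _)
  let z' : 𝓞 K := ⟨z, hz⟩
  have hz' : z' ^ 2 = (((u : (𝓞 K)ˣ) * (w : (𝓞 K)ˣ) : (𝓞 K)ˣ) : 𝓞 K) := by
    apply NumberField.RingOfIntegers.ext
    simp only [Units.val_mul, map_mul, map_pow]
    exact h.symm
  have hunit : IsUnit z' := by
    rw [← isUnit_pow_iff two_ne_zero, hz']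
    exact Units.isUnit _
  obtain ⟨ζ, hζ⟩ := hunit
  rw [← hζ, ← Units.val_pow_eq_pow_val, Units.val_inj] at hz'
  rw [QuotientGroup.eq, Subgroup.mem_subgroupOf]
  refine ⟨(u : (𝓞 K)ˣ)⁻¹ * ζ, ?_⟩
  simp only [powMonoidHom_apply, Subgroup.coe_mul, Subgroup.coe_inv]
  rw [mul_pow, hz', sq, mul_assoc, inv_mul_cancel_left]

/-- The product of the units `u` and `w` lies in `γ_K K^{×2}`. -/
def GammaRelated (u w : totallyPositiveUnits K) : Prop :=
  ∃ y : K, y ≠ 0 ∧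
    (((u : (𝓞 K)ˣ) : 𝓞 K) : K) * (((w : (𝓞 K)ˣ) : 𝓞 K) : K) = gamma K * y ^ 2

theorem GammaRelated.symm {u w : totallyPositiveUnits K} (h : GammaRelated u w) :
    GammaRelated w u := by
  obtain ⟨y, hy, e⟩ := h
  exact ⟨y, hy, by rw [mul_comm, e]⟩

theorem exists_mul_eq_sq_of_class_eq {u u' : totallyPositiveUnits K}
    (h : (u : UnitSquareClasses K) = u') : ∃ z : K, z ≠ 0 ∧
      (((u : (𝓞 K)ˣ) : 𝓞 K) : K) * (((u' : (𝓞 K)ˣ) : 𝓞 K) : K) = z ^ 2 := by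
  rw [QuotientGroup.eq, Subgroup.mem_subgroupOf] at h
  obtain ⟨s, hs⟩ := h
  simp only [powMonoidHom_apply, Subgroup.coe_mul, Subgroup.coe_inv] at hs
  refine ⟨(((u * s : (𝓞 K)ˣ) : 𝓞 K) : K), coe_unit_ne_zero _, ?_⟩
  rw [← map_mul, ← map_pow, ← Units.val_mul, ← Units.val_pow_eq_pow_val, mul_pow, hs, sq,
    mul_assoc, mul_inv_cancel_left]

/-- Every class is related by `γ_K` to at most one class. -/
theorem GammaRelated.class_eq {u u' w w' : totallyPositiveUnits K} (h : GammaRelated u w)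
    (h' : GammaRelated u' w') (hu : (u : UnitSquareClasses K) = u') :
    (w : UnitSquareClasses K) = w' := by
  obtain ⟨y, -, e⟩ := h
  obtain ⟨y', -, e'⟩ := h'
  obtain ⟨z, hz, ez⟩ := exists_mul_eq_sq_of_class_eq hu
  -- `(uw)(u'w') = (γ y y')²`, and `uu' = z²` divides out.
  refine class_eq_of_mul_eq_sq (z := gamma K * y * y' / z) ?_
  rw [div_pow, eq_div_iff (pow_ne_zero 2 hz), ← ez]
  calc _ = ((((u : (𝓞 K)ˣ) : 𝓞 K) : K) * (((w : (𝓞 K)ˣ) : 𝓞 K) : K)) *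
        ((((u' : (𝓞 K)ˣ) : 𝓞 K) : K) * (((w' : (𝓞 K)ˣ) : 𝓞 K) : K)) := by ring
    _ = _ := by rw [e, e']; ring

/-! ### Orthogonalization in positive definite lattices. -/

section Lattice

variable {L : Type*} [AddCommGroup L] [Module (𝓞 K) L] {Q : QuadraticForm (𝓞 K) L}

theorem ne_zero_of_apply_eq_unit {v : L} {u : (𝓞 K)ˣ} (h : Q v = (u : 𝓞 K)) : v ≠ 0 := by
  rintro rfl
  rw [QuadraticMap.map_zero] at h
  exact u.ne_zero h.symm

theorem IsPositiveDefinite.apply_ne_zero [NumberField.IsTotallyReal K]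
    (hQ : IsPositiveDefinite Q) {v : L} (hv : v ≠ 0) : Q v ≠ 0 := by
  intro h
  obtain ⟨σ⟩ := exists_ringHom_real K
  simpa [h] using hQ v hv σ

theorem IsPositiveDefinite.nonneg (hQ : IsPositiveDefinite Q) (v : L) (σ : K →+* ℝ) :
    0 ≤ σ (Q v : K) := by
  by_cases hv : v = 0
  · simp [hv]
  · exact (hQ v hv σ).le

theorem map_smul_add_smul (Q : QuadraticForm (𝓞 K) L) (a b : 𝓞 K) (v w : L) :
    Q (a • v + b • w) = a ^ 2 * Q v + b ^ 2 * Q w + a * b * QuadraticMap.polar Q v w := by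
  rw [QuadraticMap.map_add Q, QuadraticMap.map_smul, QuadraticMap.map_smul,
    QuadraticMap.polar_smul_left, QuadraticMap.polar_smul_right]
  simp only [smul_eq_mul]
  ring

theorem polar_smul_add_smul (Q : QuadraticForm (𝓞 K) L) (a b : 𝓞 K) (v w : L) :
    QuadraticMap.polar Q v (a • w + b • v) = a * QuadraticMap.polar Q v w + 2 * b * Q v := by
  rw [QuadraticMap.polar_add_right, QuadraticMap.polar_smul_right, QuadraticMap.polar_smul_right,
    QuadraticMap.polar_self]
  simp only [smul_eq_mul, nsmul_eq_mul, Nat.cast_ofNat]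
  ring

/-- The Cauchy–Schwarz inequality. -/
theorem IsPositiveDefinite.polar_sq_le (hQ : IsPositiveDefinite Q) (v w : L) (hv : v ≠ 0)
    (σ : K →+* ℝ) :
    σ ((QuadraticMap.polar Q v w : 𝓞 K) : K) ^ 2 ≤ 4 * (σ (Q v : K) * σ (Q w : K)) := by
  -- The value of `Q` at this denominator-free projection is `Q(v) (4 Q(v) Q(w) - B²)`.
  have h := hQ.nonneg ((2 * Q v) • w + (-QuadraticMap.polar Q v w) • v) σ
  have hpos := hQ v hv σ
  rw [map_smul_add_smul, QuadraticMap.polar_comm Q w v] at h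
  simp only [map_add, map_mul, map_pow, map_neg, map_ofNat] at h
  have h2 : 0 ≤ σ (Q v : K) * (4 * (σ (Q v : K) * σ (Q w : K)) -
      σ ((QuadraticMap.polar Q v w : 𝓞 K) : K) ^ 2) := by
    refine h.trans_eq ?_
    ring
  linarith [nonneg_of_mul_nonneg_right h2 hpos]

/-- Vectors representing units in distinct classes, not related by `γ_K`, can be made
orthogonal without changing the represented units. -/
theorem exists_orthogonal [Algebra.IsAlgebraic ℚ K] [NumberField.IsTotallyReal K]
    (hQ : IsPositiveDefinite Q) {u w : totallyPositiveUnits K} {v v' : L}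
    (hv : Q v = ((u : (𝓞 K)ˣ) : 𝓞 K)) (hv' : Q v' = ((w : (𝓞 K)ˣ) : 𝓞 K))
    (huw : (u : UnitSquareClasses K) ≠ w) (hγ : ¬ GammaRelated u w) :
    ∃ a b : 𝓞 K, QuadraticMap.polar Q v (a • v' + b • v) = 0 ∧
      Q (a • v' + b • v) = ((w : (𝓞 K)ˣ) : 𝓞 K) := by
  set B := QuadraticMap.polar Q v v' with hB
  have hv0 : v ≠ 0 := ne_zero_of_apply_eq_unit hv
  by_cases hB0 : B = 0
  · exact ⟨1, 0, by simp [← hB, hB0], by simp [hv']⟩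
  have hBK : (B : K) ≠ 0 := by simpa using hB0
  obtain ⟨x, hx'⟩ : ∃ x : 𝓞 K, x * ((u : (𝓞 K)ˣ) * (w : (𝓞 K)ˣ) : 𝓞 K) = B ^ 2 := by
    refine ⟨B ^ 2 * (((u : (𝓞 K)ˣ) * (w : (𝓞 K)ˣ))⁻¹ : (𝓞 K)ˣ), ?_⟩
    rw [mul_assoc, ← Units.val_mul, Units.inv_mul, mul_one]
  have hx : (x : K) * ((((u : (𝓞 K)ˣ) : 𝓞 K) : K) * (((w : (𝓞 K)ˣ) : 𝓞 K) : K)) =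
      (B : K) ^ 2 := by
    rw [← map_mul, ← map_mul, hx', map_pow]
  have hxσ : ∀ σ : K →+* ℝ, 0 ≤ σ (x : K) ∧ σ (x : K) ≤ 4 := by
    intro σ
    have h1 := congrArg σ hx
    simp only [map_mul, map_pow] at h1
    have h2 := hQ.polar_sq_le v v' hv0 σ
    rw [← hB, hv, hv', ← h1] at h2
    have hp : 0 < σ (((u : (𝓞 K)ˣ) : 𝓞 K) : K) * σ (((w : (𝓞 K)ˣ) : 𝓞 K) : K) :=
      mul_pos (u.2 σ) (w.2 σ)
    exact ⟨nonneg_of_mul_nonneg_left (h1 ▸ sq_nonneg _) hp, le_of_mul_le_mul_right h2 hp⟩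
  obtain ⟨a, ha⟩ := exists_eq_g_sq (NumberField.RingOfIntegers.isIntegral_coe x) hxσ
  have hga0 : g a ≠ 0 := by
    intro h0
    rw [h0, zero_pow two_ne_zero, ZeroMemClass.coe_eq_zero] at ha
    refine pow_ne_zero 2 hBK (hx.symm.trans ?_)
    rw [show (x : K) = 0 from ha, zero_mul]
  have hx0 : (x : K) ≠ 0 := fun h0 => pow_ne_zero 2 hBK (by rw [← hx, h0, zero_mul])
  rcases g_sq_trichotomy (ha ▸ (x : K).2 : g a ^ 2 ∈ K) hga0 with
    hz | ⟨y, hy, hy0, e⟩ | ⟨y, hy, hy0, hyi', e⟩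
  · refine absurd (class_eq_of_mul_eq_sq (z := (B : K) / ⟨g a, hz⟩) ?_) huw
    have : (x : K) = (⟨g a, hz⟩ : K) ^ 2 := Subtype.ext ha
    rw [div_pow, ← this, ← hx, mul_div_cancel_left₀ _ hx0]
  · refine absurd ?_ hγ
    have hxe : (x : K) = gamma K * (⟨y, hy⟩ : K) ^ 2 := Subtype.ext (ha.trans e)
    have hγ0 : gamma K ≠ 0 := left_ne_zero_of_mul (hxe ▸ hx0)
    have hyK : (⟨y, hy⟩ : K) ≠ 0 := fun h => hy0 (congrArg Subtype.val h)
    refine ⟨(B : K) / (gamma K * ⟨y, hy⟩), div_ne_zero hBK (mul_ne_zero hγ0 hyK), ?_⟩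
    rw [hxe] at hx
    field_simp
    linear_combination hx
  · have hyK : (⟨y, hy⟩ : K) ≠ 0 := fun h => hy0 (congrArg Subtype.val h)
    have hint : IsIntegral ℤ (⟨y, hy⟩⁻¹ : K) :=
      (isIntegral_algHom_iff (algebraMap K ℂ).toIntAlgHom (algebraMap K ℂ).injective).mp hyi'
    let η : 𝓞 K := ⟨_, hint⟩
    have hη : (4 - x) * η ^ 2 = 1 := by
      apply NumberField.RingOfIntegers.ext
      have : 4 - (x : K) = (⟨y, hy⟩ : K) ^ 2 := Subtype.ext (by
        rw [← ha] at e; exact e)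
      simp only [map_mul, map_sub, map_pow, map_ofNat, map_one]
      rw [this]
      change (⟨y, hy⟩ : K) ^ 2 * (⟨y, hy⟩⁻¹ : K) ^ 2 = 1
      field_simp
    have hui : (((u : (𝓞 K)ˣ)⁻¹ : (𝓞 K)ˣ) : 𝓞 K) * (u : (𝓞 K)ˣ) = 1 := Units.inv_mul _
    -- The vector is `η (2v' - B u⁻¹ v)`, with value `η² w (4 - x) = w`.
    refine ⟨2 * η, -(η * B * ((u : (𝓞 K)ˣ)⁻¹ : (𝓞 K)ˣ)), ?_, ?_⟩
    · rw [polar_smul_add_smul, ← hB, hv]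
      linear_combination (-(2 * η * B)) * hui
    · rw [map_smul_add_smul, QuadraticMap.polar_comm Q v' v, ← hB, hv, hv']
      generalize (((u : (𝓞 K)ˣ)⁻¹ : (𝓞 K)ˣ) : 𝓞 K) = u' at *
      linear_combination ((w : (𝓞 K)ˣ) : 𝓞 K) * hη +
        (η ^ 2 * B ^ 2 * u' - x * η ^ 2 * (w : (𝓞 K)ˣ)) * hui + η ^ 2 * u' * hx'

/-! ### Counting classes by splitting off orthogonal vectors. -/

/-- Pairwise orthogonal nonzero vectors in `N` are at most `n` in number. -/
def OrthogonalBound (Q : QuadraticForm (𝓞 K) L) (N : Submodule (𝓞 K) L) (n : ℕ) : Prop :=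
  ∀ s : Finset L, (∀ v ∈ s, v ∈ N ∧ v ≠ 0) →
    (∀ v ∈ s, ∀ w ∈ s, v ≠ w → QuadraticMap.polar Q v w = 0) → s.card ≤ n

/-- The vectors of `N` orthogonal to `v`. -/
noncomputable def orthogonalIn (Q : QuadraticForm (𝓞 K) L) (N : Submodule (𝓞 K) L) (v : L) :
    Submodule (𝓞 K) L :=
  N ⊓ LinearMap.ker (Q.polarBilin v)

theorem mem_orthogonalIn {N : Submodule (𝓞 K) L} {v w : L} :
    w ∈ orthogonalIn Q N v ↔ w ∈ N ∧ QuadraticMap.polar Q v w = 0 := Iff.rfl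

/-- The classes of totally positive units represented by vectors of `N`. -/
def classesIn (Q : QuadraticForm (𝓞 K) L) (N : Submodule (𝓞 K) L) : Set (UnitSquareClasses K) :=
  {c | ∃ u : totallyPositiveUnits K, (u : UnitSquareClasses K) = c ∧
    ∃ v ∈ N, Q v = ((u : (𝓞 K)ˣ) : 𝓞 K)}

theorem OrthogonalBound.eq_zero {N : Submodule (𝓞 K) L} (h : OrthogonalBound Q N 0) {v : L}
    (hv : v ∈ N) : v = 0 := by
  by_contra hv0
  have := h {v} (by simpa using ⟨hv, hv0⟩) (by
    intro a ha b hb hab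
    rw [Finset.mem_singleton] at ha hb
    exact absurd (ha.trans hb.symm) hab)
  simp at this

theorem OrthogonalBound.classesIn_eq_empty {N : Submodule (𝓞 K) L} (h : OrthogonalBound Q N 0) :
    classesIn Q N = ∅ := by
  rw [Set.eq_empty_iff_forall_notMem]
  rintro _ ⟨u, rfl, v, hv, hu⟩
  exact ne_zero_of_apply_eq_unit hu (h.eq_zero hv)

variable [NumberField.IsTotallyReal K]

theorem IsPositiveDefinite.polar_self_ne_zero (hQ : IsPositiveDefinite Q) {v : L} (hv : v ≠ 0) :
    QuadraticMap.polar Q v v ≠ 0 := by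
  rw [QuadraticMap.polar_self, two_nsmul, ← two_mul]
  exact mul_ne_zero two_ne_zero (hQ.apply_ne_zero hv)

theorem OrthogonalBound.orthogonalIn {N : Submodule (𝓞 K) L} {n : ℕ}
    (h : OrthogonalBound Q N (n + 1)) (hQ : IsPositiveDefinite Q) {v : L} (hvN : v ∈ N)
    (hv : v ≠ 0) : OrthogonalBound Q (orthogonalIn Q N v) n := by
  classical
  intro s hs hs'
  have hvs : v ∉ s := fun hm => hQ.polar_self_ne_zero hv (mem_orthogonalIn.mp (hs v hm).1).2
  have := h (insert v s) ?_ ?_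
  · rw [Finset.card_insert_of_notMem hvs] at this
    omega
  · intro w hw
    rcases Finset.mem_insert.mp hw with rfl | hw
    · exact ⟨hvN, hv⟩
    · exact ⟨(hs w hw).1.1, (hs w hw).2⟩
  · intro a ha b hb hab
    rcases Finset.mem_insert.mp ha with rfl | ha' <;> rcases Finset.mem_insert.mp hb with rfl | hb'
    · exact absurd rfl hab
    · exact (mem_orthogonalIn.mp (hs b hb').1).2
    · rw [QuadraticMap.polar_comm]
      exact (mem_orthogonalIn.mp (hs a ha').1).2
    · exact hs' a ha' b hb' hab

/-- In rank one, all represented classes coincide. -/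
theorem OrthogonalBound.class_eq {N : Submodule (𝓞 K) L} (h : OrthogonalBound Q N 1)
    (hQ : IsPositiveDefinite Q) {c d : UnitSquareClasses K} (hc : c ∈ classesIn Q N)
    (hd : d ∈ classesIn Q N) : c = d := by
  obtain ⟨u, rfl, v, hv, hu⟩ := hc
  obtain ⟨w, rfl, v', hv', hw⟩ := hd
  have h0 := h.orthogonalIn hQ hv (ne_zero_of_apply_eq_unit hu)
  -- The projection of `v'` lies in a complement with bound 0, so it vanishes; evaluating `Q` gives
  -- `4uw = B²`.
  have hz := h0.eq_zero (v := (2 * Q v) • v' + (-QuadraticMap.polar Q v v') • v) (by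
    refine mem_orthogonalIn.mpr ⟨N.add_mem (N.smul_mem _ hv') (N.smul_mem _ hv), ?_⟩
    rw [polar_smul_add_smul]; ring)
  have h1 := congrArg Q hz
  rw [map_smul_add_smul, QuadraticMap.map_zero, QuadraticMap.polar_comm Q v' v, hu, hw] at h1
  have h2 : 4 * (((u : (𝓞 K)ˣ) : 𝓞 K) * ((w : (𝓞 K)ˣ) : 𝓞 K)) = QuadraticMap.polar Q v v' ^ 2 := by
    apply mul_left_cancel₀ (u : (𝓞 K)ˣ).ne_zero
    linear_combination h1
  refine class_eq_of_mul_eq_sq (z := ((QuadraticMap.polar Q v v' : 𝓞 K) : K) / 2) ?_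
  have h3 := congrArg (algebraMap (𝓞 K) K) h2
  simp only [map_mul, map_pow, map_ofNat] at h3
  linear_combination h3 / 4

variable [Algebra.IsAlgebraic ℚ K]

theorem mem_classesIn_orthogonalIn (hQ : IsPositiveDefinite Q) {N : Submodule (𝓞 K) L}
    {u w : totallyPositiveUnits K} {v : L} (hvN : v ∈ N) (hv : Q v = ((u : (𝓞 K)ˣ) : 𝓞 K))
    (hw : (w : UnitSquareClasses K) ∈ classesIn Q N) (huw : (u : UnitSquareClasses K) ≠ w)
    (hγ : ∀ w' : totallyPositiveUnits K, (w' : UnitSquareClasses K) = w → ¬ GammaRelated u w') :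
    (w : UnitSquareClasses K) ∈ classesIn Q (orthogonalIn Q N v) := by
  obtain ⟨w', hw', v', hv'N, hv'⟩ := hw
  obtain ⟨a, b, h0, h1⟩ := exists_orthogonal hQ hv hv' (hw' ▸ huw) (hγ w' hw')
  exact ⟨w', hw', _, mem_orthogonalIn.mpr
    ⟨N.add_mem (N.smul_mem _ hv'N) (N.smul_mem _ hvN), h0⟩, h1⟩

/-- With no related pairs, passing to the complement of a vector representing `u` loses only the
class of `u`. -/
theorem encard_classesIn_le (hQ : IsPositiveDefinite Q)
    (hγ : ∀ u w : totallyPositiveUnits K, ¬ GammaRelated u w) (n : ℕ) :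
    ∀ N : Submodule (𝓞 K) L, OrthogonalBound Q N n → (classesIn Q N).encard ≤ n := by
  induction n with
  | zero => intro N h; simp [h.classesIn_eq_empty]
  | succ n ih =>
    intro N h
    rcases (classesIn Q N).eq_empty_or_nonempty with h0 | ⟨c, hc⟩
    · simp [h0]
    obtain ⟨u, rfl, v, hvN, hv⟩ := hc
    have hsub : classesIn Q N ⊆
        insert (u : UnitSquareClasses K) (classesIn Q (orthogonalIn Q N v)) := by
      intro d hd
      obtain ⟨w, rfl⟩ := QuotientGroup.mk_surjective d
      by_cases huw : (u : UnitSquareClasses K) = w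
      · exact Or.inl huw.symm
      · exact Or.inr (mem_classesIn_orthogonalIn hQ hvN hv hd huw fun w' _ => hγ u w')
    calc _ ≤ _ := Set.encard_le_encard hsub
      _ ≤ (classesIn Q (orthogonalIn Q N v)).encard + 1 := Set.encard_insert_le _ _
      _ ≤ n + 1 := by
        gcongr
        exact ih _ (h.orthogonalIn hQ hvN (ne_zero_of_apply_eq_unit hv))
      _ = _ := by push_cast; rfl

/-- In rank two, at most two classes are represented. -/
theorem encard_classesIn_le_two (hQ : IsPositiveDefinite Q) {N : Submodule (𝓞 K) L}
    (h : OrthogonalBound Q N 2) : (classesIn Q N).encard ≤ 2 := by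
  by_contra! hlt
  have h3 : (3 : ℕ∞) ≤ (classesIn Q N).encard := Order.add_one_le_of_lt hlt
  obtain ⟨t, ht, ht3⟩ := Set.exists_subset_encard_eq h3
  obtain ⟨c₁, c₂, c₃, h12, h13, h23, rfl⟩ := Set.encard_eq_three.mp ht3
  -- If `c` is unrelated to `d` and `e`, both survive in the complement, where the bound is 1, so
  -- they coincide. Some class among three always qualifies, because each is related to at most one
  -- class.
  have key : ∀ c ∈ classesIn Q N, ∀ d ∈ classesIn Q N, ∀ e ∈ classesIn Q N, c ≠ d → c ≠ e →
      d ≠ e → (∀ u w : totallyPositiveUnits K, (u : UnitSquareClasses K) = c →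
        (w : UnitSquareClasses K) = d ∨ (w : UnitSquareClasses K) = e → ¬ GammaRelated u w) →
      False := by
    rintro _ ⟨u, rfl, v, hvN, hv⟩ d hd e he hcd hce hde hγ
    obtain ⟨w, rfl⟩ := QuotientGroup.mk_surjective d
    obtain ⟨w', rfl⟩ := QuotientGroup.mk_surjective e
    refine hde ((h.orthogonalIn hQ hvN (ne_zero_of_apply_eq_unit hv)).class_eq hQ
      (mem_classesIn_orthogonalIn hQ hvN hv hd hcd fun x hx => hγ u x rfl (Or.inl hx))
      (mem_classesIn_orthogonalIn hQ hvN hv he hce fun x hx => hγ u x rfl (Or.inr hx)))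
  obtain ⟨m₁, m₂, m₃⟩ : c₁ ∈ classesIn Q N ∧ c₂ ∈ classesIn Q N ∧ c₃ ∈ classesIn Q N :=
    ⟨ht (by simp), ht (by simp), ht (by simp)⟩
  by_cases hR : ∃ u w : totallyPositiveUnits K, (u : UnitSquareClasses K) = c₁ ∧
      (w : UnitSquareClasses K) = c₂ ∧ GammaRelated u w
  · obtain ⟨u, w, hu, hw, hγ⟩ := hR
    refine key c₃ m₃ c₁ m₁ c₂ m₂ h13.symm h23.symm h12 ?_
    rintro a b ha (hb | hb) hab
    · exact h23 (hw.symm.trans ((hγ.class_eq hab.symm (hu.trans hb.symm)).trans ha))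
    · exact h13 (hu.symm.trans ((hγ.symm.class_eq hab.symm (hw.trans hb.symm)).trans ha))
  by_cases hR' : ∃ u w : totallyPositiveUnits K, (u : UnitSquareClasses K) = c₁ ∧
      (w : UnitSquareClasses K) = c₃ ∧ GammaRelated u w
  · obtain ⟨u, w, hu, hw, hγ⟩ := hR'
    refine key c₂ m₂ c₁ m₁ c₃ m₃ h12.symm h23 h13 ?_
    rintro a b ha (hb | hb) hab
    · exact hR ⟨b, a, hb, ha, hab.symm⟩
    · exact h12 (hu.symm.trans ((hγ.symm.class_eq hab.symm (hw.trans hb.symm)).trans ha))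
  · refine key c₁ m₁ c₂ m₂ c₃ m₃ h12 h13 h23 ?_
    rintro a b ha (hb | hb) hab
    · exact hR ⟨a, b, ha, hb, hab⟩
    · exact hR' ⟨a, b, ha, hb, hab⟩

/-- Each split loses the class of `u` and at most one related class `c'`. -/
theorem encard_classesIn_le_two_mul (hQ : IsPositiveDefinite Q) (n : ℕ) :
    ∀ N : Submodule (𝓞 K) L, OrthogonalBound Q N (n + 2) →
      (classesIn Q N).encard ≤ ((2 * (n + 2) - 2 : ℕ) : ℕ∞) := by
  induction n with
  | zero => intro N h; exact encard_classesIn_le_two hQ h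
  | succ n ih =>
    intro N h
    rcases (classesIn Q N).eq_empty_or_nonempty with h0 | ⟨c, hc⟩
    · simp [h0]
    obtain ⟨u, rfl, v, hvN, hv⟩ := hc
    obtain ⟨c', hc'⟩ : ∃ c' : UnitSquareClasses K, ∀ w : totallyPositiveUnits K,
        GammaRelated u w → (w : UnitSquareClasses K) = c' := by
      by_cases hR : ∃ w : totallyPositiveUnits K, GammaRelated u w
      · obtain ⟨w, hw⟩ := hR
        exact ⟨w, fun w' h' => h'.class_eq hw rfl⟩
      -- Nothing is related to `u`, so the choice of class is arbitrary.
      · exact ⟨1, fun w hw => absurd ⟨w, hw⟩ hR⟩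
    have hsub : classesIn Q N ⊆
        insert (u : UnitSquareClasses K) (insert c' (classesIn Q (orthogonalIn Q N v))) := by
      intro d hd
      obtain ⟨w, rfl⟩ := QuotientGroup.mk_surjective d
      by_cases huw : (u : UnitSquareClasses K) = w
      · exact Or.inl huw.symm
      by_cases hwc : (w : UnitSquareClasses K) = c'
      · exact Or.inr (Or.inl hwc)
      · exact Or.inr (Or.inr (mem_classesIn_orthogonalIn hQ hvN hv hd huw fun w' hw' hγ =>
          hwc (hw'.symm.trans (hc' w' hγ))))
    calc _ ≤ _ := Set.encard_le_encard hsub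
      _ ≤ (classesIn Q (orthogonalIn Q N v)).encard + 1 + 1 :=
        (Set.encard_insert_le _ _).trans (add_le_add_left (Set.encard_insert_le _ _) 1)
      _ ≤ ((2 * (n + 2) - 2 : ℕ) : ℕ∞) + 1 + 1 := by
        gcongr
        exact ih _ (h.orthogonalIn hQ hvN (ne_zero_of_apply_eq_unit hv))
      _ = _ := by
        rw [show 2 * (n + 1 + 2) - 2 = 2 * (n + 2) - 2 + 1 + 1 by omega]
        push_cast; rfl

end Lattice

/-! ### Comparison with the rank and conclusion. -/

/-- In a positive definite lattice, pairwise orthogonal nonzero vectors are at most as many as the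
rank. -/
theorem orthogonalBound_latticeRank {K : IntermediateField ℚ ℂ} [NumberField.IsTotallyReal K]
    {L : Type*} [AddCommGroup L] [Module (𝓞 K) L] [Module.Finite (𝓞 K) L]
    {Q : QuadraticForm (𝓞 K) L} (hQ : IsPositiveDefinite Q) (N : Submodule (𝓞 K) L) :
    OrthogonalBound Q N (latticeRank K L) := by
  intro s hs hs'
  have hlin : LinearIndependent (𝓞 K) (fun v : s => (v : L)) := by
    rw [Fintype.linearIndependent_iff]
    intro c hc i
    have h1 := congrArg (Q.polarBilin (i : L)) hc
    rw [map_sum, map_zero, Finset.sum_eq_single i] at h1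
    · rw [map_smul, smul_eq_mul] at h1
      exact (mul_eq_zero.mp h1).resolve_right (hQ.polar_self_ne_zero (hs i i.2).2)
    · intro j _ hj
      rw [map_smul]
      have : Q.polarBilin (i : L) (j : L) = 0 :=
        hs' i i.2 j j.2 fun h => hj (Subtype.ext h.symm)
      rw [this, smul_zero]
    · simp
  have hr : latticeRank K L = Module.finrank (𝓞 K) L :=
    (TensorProduct.isBaseChange (𝓞 K) L K).finrank_eq
  rw [hr]
  simpa using hlin.fintype_card_le_finrank

theorem representedClasses_eq_classesIn_top {K : IntermediateField ℚ ℂ} {L : Type*}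
    [AddCommGroup L] [Module (𝓞 K) L] (Q : QuadraticForm (𝓞 K) L) :
    representedClasses Q = classesIn Q ⊤ := by
  ext c
  simp [representedClasses, classesIn, Represents]

theorem IsUniversal.representedClasses_eq_univ {K : IntermediateField ℚ ℂ} {L : Type*}
    [AddCommGroup L] [Module (𝓞 K) L] {Q : QuadraticForm (𝓞 K) L} (hQ : IsUniversal Q) :
    representedClasses Q = Set.univ := by
  rw [Set.eq_univ_iff_forall]
  intro c
  obtain ⟨u, rfl⟩ := QuotientGroup.mk_surjective c
  exact ⟨u, rfl, hQ.2 _ u.2⟩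

end QuadLat

theorem theorem3p2 (K : IntermediateField ℚ ℂ) [Algebra.IsAlgebraic ℚ K]
    [NumberField.IsTotallyReal K] :
    (∀ (L : Type*) [AddCommGroup L] [Module (𝓞 K) L] [Module.Finite (𝓞 K) L]
        [Module.IsTorsionFree (𝓞 K) L] (Q : QuadraticForm (𝓞 K) L) (n : ℕ),
        2 ≤ n → QuadLat.latticeRank K L = n → QuadLat.IsPositiveDefinite Q →
          (QuadLat.representedClasses Q).encard ≤ ((2 * n - 2 : ℕ) : ℕ∞) ∧
          ({x : K | ∃ y : K, y ≠ 0 ∧ x = QuadLat.gamma K * y ^ 2} ∩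
              {x : K | ∃ u ∈ QuadLat.totallyPositiveUnits K, x = ((u : 𝓞 K) : K)} = ∅ →
            (QuadLat.representedClasses Q).encard ≤ (n : ℕ∞))) ∧
    (Infinite (QuadLat.UnitSquareClasses K) →
      ∀ (L : Type*) [AddCommGroup L] [Module (𝓞 K) L] [Module.Finite (𝓞 K) L]
        [Module.IsTorsionFree (𝓞 K) L] (Q : QuadraticForm (𝓞 K) L),
        ¬ QuadLat.IsUniversal Q) := by
  refine ⟨fun L _ _ _ _ Q n hn hrank hQ => ?_, fun hinf L _ _ _ _ Q hQ => ?_⟩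
  · have hb := QuadLat.orthogonalBound_latticeRank hQ ⊤
    rw [hrank] at hb
    rw [QuadLat.representedClasses_eq_classesIn_top]
    refine ⟨?_, fun hγ => ?_⟩
    · obtain ⟨m, rfl⟩ := Nat.exists_eq_add_of_le' hn
      exact QuadLat.encard_classesIn_le_two_mul hQ m _ hb
    · refine QuadLat.encard_classesIn_le hQ ?_ n _ hb
      rintro u w ⟨y, hy, e⟩
      refine (Set.eq_empty_iff_forall_notMem.mp hγ) _ ⟨⟨y, hy, rfl⟩, _, (u * w).2, ?_⟩
      rw [← e, ← map_mul]
      rfl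
  -- Enlarging the bound by 2 covers ranks 0 and 1 as well; only finiteness matters here.
  · have hb : QuadLat.OrthogonalBound Q ⊤ (QuadLat.latticeRank K L + 2) := fun s hs hs' =>
      (QuadLat.orthogonalBound_latticeRank hQ.1 ⊤ s hs hs').trans (Nat.le_add_right _ 2)
    have hle := QuadLat.encard_classesIn_le_two_mul hQ.1 _ _ hb
    rw [← QuadLat.representedClasses_eq_classesIn_top, hQ.representedClasses_eq_univ,
      Set.encard_univ, ENat.card_eq_top_of_infinite, top_le_iff] at hle
    exact ENat.natCast_ne_top _ hle
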